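/- Let $q\ge 3$ be a prime power, let $m\ge 2$ be an integer, let $\lambda$ be a positive divisor of $q-1$ with $\lambda\ne q-1$, and put $n=\frac{q^m-1}{\lambda}$. Let $\beta\in\mathbb F_{q^m}$ be a primitive $n$-th root of unity and, for $i\in\mathbb Z$, let $m_i(x)$ be the minimal polynomial of $\beta^i$ over $\mathbb F_q$. For integers $b$ and $2\le\delta\le n$, let $\mathcal C_{(\delta,b)}\subseteq\mathbb F_q^n$ be the cyclic code of length $n$ over $\mathbb F_q$ with generator polynomial $\mathrm{lcm}(m_b(x),m_{b+1}(x),\dots,m_{b+\delta-2}(x))$, i.e. the set of $(c_0,\dots,c_{n-1})$ for which the class of $c_0+c_1x+\cdots+c_{n-1}x^{n-1}$ in $\mathbb F_q[x]/(x^n-1)$ lies in the ideal generated by this polynomial. A code of length $n$ is called a BCH code with respect to $\beta$ if it equals $\mathcal C_{(\delta',b)}$ for some integers $b$ and $2\le\delta'\le n$. Write $\mathcal C_\delta=\mathcal C_{(\delta,1)}$, and call $\mathcal C_\delta$ dually-BCH if both $\mathcal C_\delta$ and its dual $\mathcal C_\delta^\perp$ (for the standard inner product on $\mathbb F_q^n$)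 are BCH codes with respect to $\beta$. The $q$-cyclotomic coset modulo $n$ of $s\in\{0,\dots,n-1\}$ is the set of residues $sq^j \bmod n$ in $\{0,\dots,n-1\}$, $j\ge 0$; its smallest element is called its coset leader. Let $\delta_1>\delta_2$ be the largest and the second largest $q$-cyclotomic coset leaders modulo $n$. Then for every integer $\delta$ with $2\le\delta\le n$: 1. if $\lambda\ne 1$, then $\mathcal C_\delta$ is dually-BCH if and only if $\delta_1<\delta\le n$; 2. if $\lambda=1$, then $\mathcal C_\delta$ is dually-BCH if and only if $\delta=2$ or $\delta_2<\delta\le n$. -/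

import Mathlib

open Polynomial

/-- The `q`-cyclotomic coset of `s` modulo `n`, with residues represented in `{0, …, n - 1}`. -/
def cyclotomicCoset (q n s : ℕ) : Set ℕ := {t | ∃ j : ℕ, t = s * q ^ j % n}

/-- `a` is a `q`-cyclotomic coset leader modulo `n`: the smallest element of some
`q`-cyclotomic coset modulo `n`. -/
def IsCosetLeader (q n a : ℕ) : Prop := ∃ s < n, IsLeast (cyclotomicCoset q n s) a

/-- The class of `c₀ + c₁ x + ⋯ + cₙ₋₁ xⁿ⁻¹` in `F[x] / (xⁿ - 1)`, as a linear map. -/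
noncomputable def wordClass (F : Type*) [Field F] (n : ℕ) :
    (Fin n → F) →ₗ[F] F[X] ⧸ Ideal.span {(X ^ n - 1 : F[X])} :=
  (Ideal.Quotient.mkₐ F (Ideal.span {(X ^ n - 1 : F[X])})).toLinearMap ∘ₗ
    ∑ i : Fin n, (monomial (i : ℕ)).comp (LinearMap.proj i)

/-- The cyclic code of length `n` over `F` given by the ideal `⟨g⟩` of `F[x] / (xⁿ - 1)`. -/
noncomputable def cyclicCode {F : Type*} [Field F] (n : ℕ) (g : F[X]) : Submodule F (Fin n → F) :=
  Submodule.comap (wordClass F n)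
    (Submodule.restrictScalars F
      (Ideal.span {Ideal.Quotient.mk (Ideal.span {(X ^ n - 1 : F[X])}) g}))

/-- The dual of a linear code with respect to the standard inner product. -/
def codeDual {F : Type*} [Field F] {n : ℕ} (C : Submodule F (Fin n → F)) :
    Submodule F (Fin n → F) where
  carrier := {b | ∀ c ∈ C, ∑ i, b i * c i = 0}
  add_mem' := by
    intro a b ha hb c hc
    change ∀ c ∈ C, ∑ i, a i * c i = 0 at ha
    change ∀ c ∈ C, ∑ i, b i * c i = 0 at hb
    simp [add_mul, Finset.sum_add_distrib, ha c hc, hb c hc]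
  zero_mem' := by
    intro c _
    simp
  smul_mem' := by
    intro r b hb c hc
    change ∀ c ∈ C, ∑ i, b i * c i = 0 at hb
    simp [mul_assoc, ← Finset.mul_sum, hb c hc]

/-- The monic least common multiple of the minimal polynomials over `F` of
`β ^ b, β ^ (b + 1), …, β ^ (b + δ - 2)`. -/
noncomputable def bchGenPoly (F : Type*) [Field F] {K : Type*} [Field K] [Algebra F K]
    (β : K) (δ : ℕ) (b : ℤ) : F[X] :=
  letI : DecidableEq F := Classical.decEq F
  letI : NormalizedGCDMonoid F[X] := UniqueFactorizationMonoid.toNormalizedGCDMonoid F[X]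
  (Finset.Icc b (b + (δ : ℤ) - 2)).lcm fun i : ℤ => minpoly F (β ^ i)

/-- The BCH code of length `n` over `F` with designed distance `δ` and offset `b`,
with respect to `β` (in the intended use, a primitive `n`-th root of unity). -/
noncomputable def bchCode (F : Type*) [Field F] {K : Type*} [Field K] [Algebra F K]
    (n : ℕ) (β : K) (δ : ℕ) (b : ℤ) : Submodule F (Fin n → F) :=
  cyclicCode n (bchGenPoly F β δ b)

/-- `C` is a BCH code with respect to `β`, for some designed distance `2 ≤ δ ≤ n` and some
integer offset. -/
def IsBCHCode {F : Type*} [Field F] {K : Type*} [Field K] [Algebra F K] {n : ℕ}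
    (β : K) (C : Submodule F (Fin n → F)) : Prop :=
  ∃ (δ : ℕ) (b : ℤ), 2 ≤ δ ∧ δ ≤ n ∧ C = bchCode F n β δ b

/-- `C` is a dually-BCH code with respect to `β`: both `C` and its dual are BCH codes with
respect to `β`. -/
def IsDuallyBCH {F : Type*} [Field F] {K : Type*} [Field K] [Algebra F K] {n : ℕ}
    (β : K) (C : Submodule F (Fin n → F)) : Prop :=
  IsBCHCode β C ∧ IsBCHCode β (codeDual C)

/-! The value of a word at `β ^ (i * q)` is the `q`-th power of its value at `β ^ i`, so a code
given by zeros is determined by a union of cyclotomic cosets. With `s = δ - 1`, the dual of `C_δ`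
has as zeros the `β ^ l` with `-l` in no coset of `{1, …, s}`. This set contains 0 and omits `-1`,
so an interval representing it must start at a multiple of `n`; it may be taken as `{0, …, r}`.
Being dually-BCH then forces the conjugates of `{1, …, r}` and of `{-1, …, -s}` to partition the
nonzero residues.

Such a partition is impossible unless `r` or `s` is very small (`not_cosetPartition`). After scaling
by `lam`, multiplication by `q` rotates base-`q` digits modulo `q ^ m - 1`. Playing a small multiple
of `lam` against its rotations shows first that `r` and `s` are not small, then that `lam * r` and
`lam * s` are below `q ^ (m - 1)`. An element near `11…1` in base `q` has all its rotations in the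
middle range, so neither side covers it.

If `δ ≤ δ₁`, the coset of `-δ₁` gives `r ≥ 1`, which suffices for `lam ≥ 2`. For `lam = 1` both `r,
s ≥ 2` are needed: `δ ≤ δ₂` gives the first and `δ ≠ 2` the second. The remaining cases have
explicit intervals: `{0}`, `{0, 1}`, and, for `δ = 2`, `{0, …, n - q ^ (m - 1) - 1}`. -/

/-- Two integers are conjugate if they lie in the same `q`-cyclotomic coset modulo `n`. -/
def CosetConj (q n : ℕ) (a b : ℤ) : Prop := ∃ j : ℕ, a * (q : ℤ) ^ j ≡ b [ZMOD n]

namespace CosetConj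

variable {q n : ℕ} {a b c : ℤ}

theorem of_modEq (h : a ≡ b [ZMOD n]) : CosetConj q n a b := ⟨0, by simpa using h⟩

theorem refl (a : ℤ) : CosetConj q n a a := of_modEq rfl

theorem trans (h : CosetConj q n a b) (h' : CosetConj q n b c) : CosetConj q n a c := by
  obtain ⟨j, hj⟩ := h
  obtain ⟨k, hk⟩ := h'
  refine ⟨j + k, ?_⟩
  rw [pow_add, ← mul_assoc]
  exact (hj.mul_right _).trans hk

theorem neg (h : CosetConj q n a b) : CosetConj q n (-a) (-b) := by
  obtain ⟨j, hj⟩ := h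
  exact ⟨j, by simpa [neg_mul] using hj.neg⟩

theorem exists_lt {m : ℕ} (hm : 0 < m) (hqm : (q : ℤ) ^ m ≡ 1 [ZMOD n])
    (h : CosetConj q n a b) : ∃ j < m, a * (q : ℤ) ^ j ≡ b [ZMOD n] := by
  obtain ⟨j, hj⟩ := h
  refine ⟨j % m, Nat.mod_lt _ hm, Int.ModEq.trans ?_ hj⟩
  conv_rhs => rw [← Nat.mod_add_div j m, pow_add, pow_mul]
  have := (hqm.pow (j / m)).mul_left (a * (q : ℤ) ^ (j % m))
  simpa [mul_assoc] using this.symm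

theorem symm {m : ℕ} (hm : 0 < m) (hqm : (q : ℤ) ^ m ≡ 1 [ZMOD n])
    (h : CosetConj q n a b) : CosetConj q n b a := by
  obtain ⟨j, hjm, hj⟩ := h.exists_lt hm hqm
  refine ⟨m - j, (hj.symm.mul_right _).trans ?_⟩
  rw [mul_assoc, ← pow_add, Nat.add_sub_cancel' hjm.le]
  simpa using hqm.mul_left a

theorem eq_zero (h : CosetConj q n a b) (ha : a ≡ 0 [ZMOD n]) : b ≡ 0 [ZMOD n] := by
  obtain ⟨j, hj⟩ := h
  exact hj.symm.trans (by simpa using ha.mul_right _)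

theorem not_zero {m : ℕ} (hm : 0 < m) (hqm : (q : ℤ) ^ m ≡ 1 [ZMOD n])
    (h : CosetConj q n a b) (ha : ¬ a ≡ 0 [ZMOD n]) : ¬ b ≡ 0 [ZMOD n] :=
  fun hb => ha ((h.symm hm hqm).eq_zero hb)

end CosetConj

/-! ### Zeros of cyclic codes and of their duals -/

section CyclicCodes

variable {F : Type*} [Field F] {K : Type*} [Field K] [Algebra F K] {n : ℕ}

/-- The value at `β ^ i` of the polynomial `c₀ + c₁ x + ⋯ + cₙ₋₁ xⁿ⁻¹`. -/
def wordEval (β : K) (c : Fin n → F) (i : ℤ) : K :=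
  ∑ k : Fin n, algebraMap F K (c k) * β ^ (i * (k : ℤ))

theorem mem_cyclicCode_iff {g : F[X]} (hg : g ∣ X ^ n - 1) (c : Fin n → F) :
    c ∈ cyclicCode n g ↔ g ∣ ∑ k : Fin n, monomial (k : ℕ) (c k) := by
  have h : wordClass F n c = Ideal.Quotient.mk (Ideal.span {(X ^ n - 1 : F[X])})
      (∑ k : Fin n, monomial (k : ℕ) (c k)) := by
    simp [wordClass]
  rw [cyclicCode, Submodule.mem_comap, Submodule.restrictScalars_mem, h,
    Ideal.mem_span_singleton]
  constructor
  · rintro ⟨r, hr⟩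
    obtain ⟨r, rfl⟩ := Ideal.Quotient.mk_surjective r
    rw [← map_mul, Ideal.Quotient.eq, Ideal.mem_span_singleton] at hr
    exact (dvd_sub_left (dvd_mul_right g r)).1 (hg.trans hr)
  · exact fun h => map_dvd _ h

theorem bchGenPoly_dvd_iff (β : K) (δ : ℕ) (b : ℤ) (p : F[X]) :
    bchGenPoly F β δ b ∣ p ↔
      ∀ i ∈ Set.Icc b (b + (δ : ℤ) - 2), aeval (β ^ i) p = 0 := by
  let _ : DecidableEq F := Classical.decEq F
  let _ : NormalizedGCDMonoid F[X] := UniqueFactorizationMonoid.toNormalizedGCDMonoid F[X]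
  refine Finset.lcm_dvd_iff.trans ?_
  simp only [Finset.mem_Icc, Set.mem_Icc, minpoly.dvd_iff]

theorem mem_bchCode_iff {β : K} (hβ : β ^ n = 1) (δ : ℕ) (b : ℤ) (c : Fin n → F) :
    c ∈ bchCode F n β δ b ↔ ∀ i ∈ Set.Icc b (b + (δ : ℤ) - 2), wordEval β c i = 0 := by
  rw [bchCode, mem_cyclicCode_iff, bchGenPoly_dvd_iff]
  · simp only [map_sum, aeval_monomial, wordEval, zpow_mul, zpow_natCast]
  · rw [bchGenPoly_dvd_iff]
    intro i _
    simp only [map_sub, map_pow, aeval_X, map_one]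
    rw [← zpow_natCast, ← zpow_mul, mul_comm, zpow_mul, zpow_natCast, hβ, one_zpow, sub_self]

theorem zpow_eq_zpow_of_modEq {β : K} (hβ : β ^ n = 1) (hn : n ≠ 0) {i j : ℤ}
    (h : i ≡ j [ZMOD n]) : β ^ i = β ^ j := by
  obtain ⟨t, ht⟩ := h.dvd
  have h0 : β ≠ 0 := by
    rintro rfl
    simp [hn] at hβ
  rw [show j = i + n * t by linarith, zpow_add₀ h0, zpow_mul, zpow_natCast, hβ, one_zpow, mul_one]

theorem wordEval_congr {β : K} (hβ : β ^ n = 1) (c : Fin n → F) {i j : ℤ}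
    (h : i ≡ j [ZMOD n]) : wordEval β c i = wordEval β c j := by
  refine Finset.sum_congr rfl fun k _ => ?_
  rw [zpow_eq_zpow_of_modEq hβ (Nat.pos_of_ne_zero (by rintro rfl; exact k.elim0)).ne'
    (h.mul_right _)]

/-- The Frobenius of `K` over `F` fixes the coefficients and raises `β` to the power `q`. -/
theorem wordEval_mul_pow [Fintype F] (β : K) (c : Fin n → F) (i : ℤ) (j : ℕ) :
    wordEval β c (i * (Fintype.card F : ℤ) ^ j) = wordEval β c i ^ Fintype.card F ^ j := by
  induction j with
  | zero => simp
  | succ j ih =>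
    rw [pow_succ, pow_succ, pow_mul, ← ih, ← mul_assoc]
    generalize i * (Fintype.card F : ℤ) ^ j = l
    have h := map_sum (FiniteField.frobeniusAlgHom F K)
      (fun k : Fin n => algebraMap F K (c k) * β ^ (l * (k : ℤ))) Finset.univ
    simp only [map_mul, AlgHom.commutes, FiniteField.coe_frobeniusAlgHom] at h
    rw [wordEval, wordEval, h]
    refine Finset.sum_congr rfl fun k _ => ?_
    rw [← zpow_natCast (β ^ _), ← zpow_mul]
    congr 2
    ring

theorem wordEval_eq_zero_of_conj [Fintype F] {β : K} (hβ : β ^ n = 1) (c : Fin n → F) {i j : ℤ}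
    (h : CosetConj (Fintype.card F) n i j) (hj : wordEval β c j = 0) : wordEval β c i = 0 := by
  obtain ⟨k, hk⟩ := h
  rw [← wordEval_congr hβ c hk, wordEval_mul_pow] at hj
  exact pow_eq_zero_iff (pow_ne_zero _ Fintype.card_ne_zero) |>.1 hj

theorem sum_zpow_eq_ite {β : K} (hβ : IsPrimitiveRoot β n) (l : ℤ) :
    ∑ k : Fin n, β ^ (l * (k : ℤ)) = if l ≡ 0 [ZMOD n] then (n : K) else 0 := by
  have h : ∑ k : Fin n, β ^ (l * (k : ℤ)) = ∑ k ∈ Finset.range n, (β ^ l) ^ k := by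
    rw [Finset.sum_range]
    simp only [zpow_mul, zpow_natCast]
  have h1 : β ^ l = 1 ↔ l ≡ 0 [ZMOD n] := by
    rw [hβ.zpow_eq_one_iff_dvd, Int.modEq_zero_iff_dvd]
  rw [h]
  split_ifs with hl
  · simp [h1.2 hl]
  · have h2 := mul_geom_sum (β ^ l) n
    rw [← zpow_natCast (β ^ l), ← zpow_mul, mul_comm l, zpow_mul, zpow_natCast, hβ.pow_eq_one,
      one_zpow, sub_self, mul_eq_zero] at h2
    exact h2.resolve_left (sub_ne_zero.2 fun h3 => hl (h1.1 h3))

/-- Parseval's identity for words. -/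
theorem sum_wordEval_mul_wordEval {β : K} (hβ : IsPrimitiveRoot β n) (b c : Fin n → F) :
    ∑ k : Fin n, wordEval β b (-(k : ℤ)) * wordEval β c k =
      n * algebraMap F K (∑ i, b i * c i) := by
  have key : ∀ i j : Fin n, ∑ k : Fin n, β ^ (-(k : ℤ) * (i : ℤ)) * β ^ ((k : ℤ) * (j : ℤ)) =
      if i = j then (n : K) else 0 := by
    intro i j
    have h0 : β ≠ 0 := hβ.ne_zero (by rintro rfl; exact i.elim0)
    have h := sum_zpow_eq_ite hβ ((j : ℤ) - i)
    have h1 : (j : ℤ) - i ≡ 0 [ZMOD n] ↔ i = j := by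
      rw [Int.modEq_zero_iff_dvd, ← Int.modEq_iff_dvd, Int.natCast_modEq_iff, Fin.ext_iff]
      exact ⟨fun h => Nat.ModEq.eq_of_lt_of_lt h i.2 j.2, fun h => by rw [h]⟩
    simp only [h1] at h
    rw [← h]
    refine Finset.sum_congr rfl fun k _ => ?_
    rw [← zpow_add₀ h0]
    congr 1
    ring
  calc _ = ∑ k : Fin n, ∑ i, ∑ j, (algebraMap F K (b i) * algebraMap F K (c j)) *
        (β ^ (-(k : ℤ) * (i : ℤ)) * β ^ ((k : ℤ) * (j : ℤ))) := by
        refine Finset.sum_congr rfl fun k _ => ?_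
        rw [wordEval, wordEval, Finset.sum_mul_sum]
        exact Finset.sum_congr rfl fun i _ => Finset.sum_congr rfl fun j _ => by ring
    _ = ∑ i, ∑ j, (algebraMap F K (b i) * algebraMap F K (c j)) *
        ∑ k : Fin n, (β ^ (-(k : ℤ) * (i : ℤ)) * β ^ ((k : ℤ) * (j : ℤ))) := by
        rw [Finset.sum_comm]
        refine Finset.sum_congr rfl fun i _ => ?_
        rw [Finset.sum_comm]
        simp only [Finset.mul_sum]
    _ = _ := by
        simp only [key, mul_ite, mul_zero, Finset.sum_ite_eq, Finset.mem_univ, if_true, map_sum,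
          map_mul, Finset.mul_sum]
        exact Finset.sum_congr rfl fun i _ => by ring

/-- The word with entries `Tr(θ β ^ (-l k))`. -/
noncomputable def traceWord (F : Type*) [Field F] {K : Type*} [Field K] [Algebra F K] (n : ℕ)
    (β θ : K) (l : ℤ) : Fin n → F :=
  fun k => Algebra.trace F K (θ * β ^ (-l * (k : ℤ)))

/-- Expanding the trace as a sum of Frobenius powers and applying orthogonality shows that the
transform of a trace word is supported on the coset of `l`. Several `j` may contribute, since that
coset can have fewer than `m` elements. -/
theorem wordEval_traceWord [Fintype F] [Finite K] {β : K} (hβ : IsPrimitiveRoot β n) (θ : K)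
    (l i : ℤ) :
    wordEval β (traceWord F n β θ l) i = ∑ j ∈ Finset.range (Module.finrank F K),
      if l * (Fintype.card F : ℤ) ^ j ≡ i [ZMOD n] then n * θ ^ Fintype.card F ^ j else 0 := by
  simp only [wordEval, traceWord, FiniteField.algebraMap_trace_eq_sum_pow,
    Nat.card_eq_fintype_card, Finset.sum_mul]
  rw [Finset.sum_comm]
  refine Finset.sum_congr rfl fun j _ => ?_
  have h := sum_zpow_eq_ite hβ (i - l * (Fintype.card F : ℤ) ^ j)
  have h1 : i - l * (Fintype.card F : ℤ) ^ j ≡ 0 [ZMOD n] ↔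
      l * (Fintype.card F : ℤ) ^ j ≡ i [ZMOD n] := by
    rw [Int.modEq_zero_iff_dvd, ← Int.modEq_iff_dvd]
  simp only [h1] at h
  calc _ = θ ^ Fintype.card F ^ j *
        ∑ k : Fin n, β ^ ((i - l * (Fintype.card F : ℤ) ^ j) * (k : ℤ)) := by
        rw [Finset.mul_sum]
        refine Finset.sum_congr rfl fun k _ => ?_
        have h0 : β ≠ 0 := hβ.ne_zero (by rintro rfl; exact k.elim0)
        rw [mul_pow, mul_assoc, ← zpow_natCast (β ^ _), ← zpow_mul, ← zpow_add₀ h0]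
        congr 2
        push_cast
        ring
    _ = _ := by
        rw [h, mul_ite, mul_zero, mul_comm (θ ^ _)]

theorem card_pow_finrank_modEq_one [Fintype F] [Finite K] {β : K} (hβ : IsPrimitiveRoot β n)
    (hn : n ≠ 0) : (Fintype.card F : ℤ) ^ Module.finrank F K ≡ 1 [ZMOD n] := by
  have := Fintype.ofFinite K
  have h : Fintype.card K = Fintype.card F ^ Module.finrank F K := Module.card_eq_pow_finrank
  have h1 : β ^ (Fintype.card K - 1) = 1 := FiniteField.pow_card_sub_one_eq_one β (hβ.ne_zero hn)
  have h2 := hβ.dvd_of_pow_eq_one _ h1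
  rw [h] at h2
  refine (Int.modEq_iff_dvd.2 ?_).symm
  have h3 : 1 ≤ Fintype.card F ^ Module.finrank F K := Nat.one_le_pow _ _ Fintype.card_pos
  simpa [Nat.cast_sub h3] using Int.natCast_dvd_natCast.2 h2

theorem wordEval_traceWord_of_not_conj [Fintype F] [Finite K] {β : K} (hβ : IsPrimitiveRoot β n)
    (θ : K) {l i : ℤ} (h : ¬ CosetConj (Fintype.card F) n l i) :
    wordEval β (traceWord F n β θ l) i = 0 := by
  rw [wordEval_traceWord hβ]
  exact Finset.sum_eq_zero fun j _ => if_neg fun hj => h ⟨j, hj⟩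

/-- The dual of the code with zeros `β ^ i`, `i ∈ A`, has the zeros `β ^ (-k)` for the `k` which
are not conjugate to an element of `A`. -/
theorem mem_codeDual_iff [Fintype F] [Finite K] {β : K} (hβ : IsPrimitiveRoot β n) (hn : n ≠ 0)
    {A : Set ℤ} {C : Submodule F (Fin n → F)}
    (hC : ∀ c, c ∈ C ↔ ∀ i ∈ A, wordEval β c i = 0) (b : Fin n → F) :
    b ∈ codeDual C ↔
      ∀ k : ℤ, (∀ i ∈ A, ¬ CosetConj (Fintype.card F) n k i) → wordEval β b (-k) = 0 := by
  constructor
  · intro hb k hk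
    -- Pairing `b` with the trace word of `θ` and `k`, which lies in `C`, gives this trace; the
    -- trace form is nondegenerate.
    have h1 : ∀ θ : K, Algebra.trace F K (wordEval β b (-k) * θ) = 0 := by
      intro θ
      have h := hb (traceWord F n β θ k)
        ((hC _).2 fun i hi => wordEval_traceWord_of_not_conj hβ θ (hk i hi))
      rw [← h, wordEval, Finset.sum_mul, map_sum]
      refine Finset.sum_congr rfl fun i _ => ?_
      rw [traceWord, ← smul_eq_mul (b i), ← map_smul, Algebra.smul_def]
      congr 1
      ring
    have : FiniteDimensional F K := Module.Finite.of_finite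
    exact (traceForm_nondegenerate F K).1 _ h1
  · intro hb c hc
    have hn' : (n : K) ≠ 0 := by
      have : NeZero n := ⟨hn⟩
      exact hβ.neZero'.out
    -- Every term of the Parseval sum vanishes: one factor for `k` outside the cosets of `A`, the
    -- other inside.
    have h := sum_wordEval_mul_wordEval hβ b c
    rw [Finset.sum_eq_zero] at h
    · have h' := (mul_eq_zero.1 h.symm).resolve_left hn'
      exact (map_eq_zero (algebraMap F K)).1 h'
    · intro k _
      by_cases hk : ∀ i ∈ A, ¬ CosetConj (Fintype.card F) n k i
      · rw [hb _ hk, zero_mul]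
      · push Not at hk
        obtain ⟨i, hi, hki⟩ := hk
        rw [wordEval_eq_zero_of_conj hβ.pow_eq_one c hki ((hC c).1 hc i hi), mul_zero]

/-- If every word with zeros in `A` has the zero `β ^ l`, then `l` is conjugate to an element
of `A`. -/
theorem exists_conj_of_forall_wordEval [Fintype F] [Finite K] {β : K} (hβ : IsPrimitiveRoot β n)
    (hn : n ≠ 0) {A : Set ℤ} {l : ℤ}
    (h : ∀ c : Fin n → F, (∀ i ∈ A, wordEval β c i = 0) → wordEval β c l = 0) :
    ∃ i ∈ A, CosetConj (Fintype.card F) n l i := by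
  by_contra! hl
  have : FiniteDimensional F K := Module.Finite.of_finite
  have := Fintype.ofFinite K
  have hn' : (n : K) ≠ 0 := by
    have : NeZero n := ⟨hn⟩
    exact hβ.neZero'.out
  set m := Module.finrank F K with hm
  set q := Fintype.card F with hq
  have hm0 : 0 < m := Module.finrank_pos
  have hq1 : 1 < q := Fintype.one_lt_card
  -- The value at `β ^ l` of the trace word of `θ`, as a polynomial in `θ`. It vanishes on all of
  -- `K` but has degree below `|K|`; its linear coefficient is `n ≠ 0`, coming from `j = 0` alone.
  let P : K[X] := ∑ j ∈ Finset.range m,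
    if l * (q : ℤ) ^ j ≡ l [ZMOD n] then C (n : K) * X ^ q ^ j else 0
  have hroot : ∀ θ : K, P.eval θ = 0 := by
    intro θ
    rw [← h (traceWord F n β θ l) fun i hi => wordEval_traceWord_of_not_conj hβ θ (hl i hi),
      wordEval_traceWord hβ, eval_finsetSum]
    refine Finset.sum_congr rfl fun j _ => ?_
    split_ifs <;> simp [hq]
  have hcoeff : P.coeff 1 = n := by
    rw [finsetSum_coeff, Finset.sum_eq_single 0]
    · simp
    · intro j _ hj
      have : 1 ≠ q ^ j := (Nat.one_lt_pow hj hq1).ne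
      split_ifs
      · simp [coeff_X_pow, this]
      · simp
    · simp [hm0.ne']
  have hdeg : P.natDegree < Fintype.card K := by
    have hK : Fintype.card K = q ^ m := Module.card_eq_pow_finrank
    refine lt_of_le_of_lt (b := q ^ (m - 1)) ?_ ?_
    · refine natDegree_sum_le_of_forall_le _ _ fun j hj => ?_
      split_ifs
      · refine (natDegree_C_mul_X_pow_le _ _).trans (Nat.pow_le_pow_right (by lia) ?_)
        have := Finset.mem_range.1 hj
        lia
      · simp
    · rw [hK]
      exact Nat.pow_lt_pow_right hq1 (by lia)
  have hP : P = 0 := eq_zero_of_natDegree_lt_card_of_eval_eq_zero P Function.injective_id hroot hdeg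
  rw [hP, coeff_zero] at hcoeff
  exact hn' hcoeff.symm

/-- The code with zeros `A` depends only on the set of conjugates of elements of `A`. -/
theorem forall_wordEval_iff [Fintype F] {β : K} (hβ : β ^ n = 1) {A B : Set ℤ}
    (hAB : ∀ a ∈ A, ∃ b ∈ B, CosetConj (Fintype.card F) n a b)
    (hBA : ∀ b ∈ B, ∃ a ∈ A, CosetConj (Fintype.card F) n b a) (c : Fin n → F) :
    (∀ i ∈ A, wordEval β c i = 0) ↔ ∀ i ∈ B, wordEval β c i = 0 := by
  constructor
  · intro h i hi
    obtain ⟨a, ha, hia⟩ := hBA i hi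
    exact wordEval_eq_zero_of_conj hβ c hia (h a ha)
  · intro h i hi
    obtain ⟨a, ha, hia⟩ := hAB i hi
    exact wordEval_eq_zero_of_conj hβ c hia (h a ha)

/-- A BCH code has a dual which is the BCH code with parameters `δ'` and `b` exactly when the
corresponding defining sets agree. -/
theorem codeDual_bchCode_eq_iff [Fintype F] [Finite K] {β : K} (hβ : IsPrimitiveRoot β n)
    (hn : n ≠ 0) (δ δ' : ℕ) (a b : ℤ) :
    codeDual (bchCode F n β δ a) = bchCode F n β δ' b ↔
      ∀ l : ℤ, (∃ i ∈ Set.Icc b (b + (δ' : ℤ) - 2), CosetConj (Fintype.card F) n l i) ↔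
        ∀ i ∈ Set.Icc a (a + (δ : ℤ) - 2), ¬ CosetConj (Fintype.card F) n (-l) i := by
  have hβ1 := hβ.pow_eq_one
  have : FiniteDimensional F K := Module.Finite.of_finite
  have hm0 : 0 < Module.finrank F K := Module.finrank_pos
  have hqm := card_pow_finrank_modEq_one (F := F) hβ hn
  let A : Set ℤ :=
    {l | ∀ i ∈ Set.Icc a (a + (δ : ℤ) - 2), ¬ CosetConj (Fintype.card F) n (-l) i}
  have hdual : ∀ c, c ∈ codeDual (bchCode F n β δ a) ↔ ∀ i ∈ A, wordEval β c i = 0 := by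
    intro c
    rw [mem_codeDual_iff hβ hn (mem_bchCode_iff hβ1 δ a)]
    constructor
    · intro h i hi
      simpa using h (-i) hi
    · intro h k hk
      exact h (-k) (by simpa [A] using hk)
  have hAconj : ∀ {x y : ℤ}, x ∈ A → CosetConj (Fintype.card F) n y x → y ∈ A :=
    fun hx hyx i hi hc => hx i hi ((hyx.symm hm0 hqm).neg.trans hc)
  constructor
  · intro h l
    constructor
    · rintro ⟨i, hi, hli⟩
      obtain ⟨k, hk, hik⟩ := exists_conj_of_forall_wordEval (F := F) (A := A) (l := i) hβ hn
        fun c hc => (mem_bchCode_iff hβ1 δ' b c).1 (h ▸ (hdual c).2 hc) i hi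
      exact hAconj hk (hli.trans hik)
    · intro hl
      exact exists_conj_of_forall_wordEval (F := F) hβ hn
        fun c hc => (hdual c).1 (h ▸ (mem_bchCode_iff hβ1 δ' b c).2 hc) l hl
  · intro h
    ext c
    rw [hdual, mem_bchCode_iff hβ1]
    exact forall_wordEval_iff hβ1 (fun l hl => (h l).2 hl)
      (fun l hl => ⟨l, (h l).1 ⟨l, hl, CosetConj.refl l⟩, CosetConj.refl l⟩) c

end CyclicCodes

/-! ### Partitions of residues and rotations modulo `q ^ m - 1` -/

section Combinatorics

variable {q m lam n : ℕ}

theorem pow_modEq_one_of_mul_eq (hN : (lam : ℤ) * n = (q : ℤ) ^ m - 1) :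
    (q : ℤ) ^ m ≡ 1 [ZMOD n] :=
  (Int.modEq_iff_dvd.2 ⟨lam, by rw [← hN, mul_comm]⟩).symm

theorem CosetConj.mul_left_modEq (hm : 0 < m) (hN : (lam : ℤ) * n = (q : ℤ) ^ m - 1) {x i : ℤ}
    (h : CosetConj q n x i) : ∃ j < m, lam * x * (q : ℤ) ^ j ≡ lam * i [ZMOD (q : ℤ) ^ m - 1] := by
  obtain ⟨j, hj, h⟩ := h.exists_lt hm (pow_modEq_one_of_mul_eq hN)
  refine ⟨j, hj, ?_⟩
  rw [mul_assoc, ← hN]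
  exact h.mul_left'

/-- All shifts of `lam * x` modulo `q ^ m - 1` have a representative in `[lo, hi]`. -/
def ShiftsIn (q m lam : ℕ) (x lo hi : ℤ) : Prop :=
  ∀ j < m, ∃ ρ : ℤ, lo ≤ ρ ∧ ρ ≤ hi ∧ lam * x * (q : ℤ) ^ j ≡ ρ [ZMOD (q : ℤ) ^ m - 1]

theorem Int.ModEq.eq_of_nonneg_of_lt {a b N : ℤ} (h : a ≡ b [ZMOD N]) (ha : 0 ≤ a) (haN : a < N)
    (hb : 0 ≤ b) (hbN : b < N) : a = b := by
  rwa [Int.ModEq, Int.emod_eq_of_lt ha haN, Int.emod_eq_of_lt hb hbN] at h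

theorem ShiftsIn.not_modEq_zero {x lo hi : ℤ} (h : ShiftsIn q m lam x lo hi) (hm : 0 < m)
    (hN : (lam : ℤ) * n = (q : ℤ) ^ m - 1) (hlo : 0 < lo) (hhi : hi < (q : ℤ) ^ m - 1) :
    ¬ x ≡ 0 [ZMOD n] := by
  intro hx
  obtain ⟨ρ, h1, h2, h3⟩ := h 0 hm
  have h4 : lam * x ≡ lam * 0 [ZMOD lam * n] := hx.mul_left'
  rw [hN, mul_zero] at h4
  rw [pow_zero, mul_one] at h3
  have := (h3.symm.trans h4).eq_of_nonneg_of_lt (by linarith) (by linarith) le_rfl (by linarith)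
  linarith

/-- Both `lam * i` and the representative `ρ` lie in the range `(0, q ^ m - 1)`, so their congruence
is an equality and `lo ≤ lam * i`. -/
theorem ShiftsIn.le_of_conj {x lo hi : ℤ} (h : ShiftsIn q m lam x lo hi) (hm : 0 < m)
    (hN : (lam : ℤ) * n = (q : ℤ) ^ m - 1) (hlam : 0 < lam) (hlo : 0 < lo)
    (hhi : hi < (q : ℤ) ^ m - 1) {i t : ℤ} (hi1 : 1 ≤ i) (hit : i ≤ t) (ht : t < n)
    (hc : CosetConj q n x i) : lo ≤ lam * t := by
  obtain ⟨j, hj, h1⟩ := hc.mul_left_modEq hm hN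
  obtain ⟨ρ, h2, h3, h4⟩ := h j hj
  have hlam' : (0 : ℤ) < lam := by exact_mod_cast hlam
  have h5 := mul_le_mul_of_nonneg_left hit hlam'.le
  have h6 := mul_lt_mul_of_pos_left ht hlam'
  have h7 := mul_le_mul_of_nonneg_left hi1 hlam'.le
  have := (h4.symm.trans h1).eq_of_nonneg_of_lt (by linarith) (by linarith) (by linarith)
    (by linarith)
  linarith

theorem ShiftsIn.neg {x lo hi : ℤ} (h : ShiftsIn q m lam x lo hi) :
    ShiftsIn q m lam (-x) ((q : ℤ) ^ m - 1 - hi) ((q : ℤ) ^ m - 1 - lo) := by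
  intro j hj
  obtain ⟨ρ, h2, h3, h4⟩ := h j hj
  refine ⟨(q : ℤ) ^ m - 1 - ρ, by linarith, by linarith, ?_⟩
  have h5 := h4.neg
  have h6 : -ρ ≡ (q : ℤ) ^ m - 1 - ρ [ZMOD (q : ℤ) ^ m - 1] :=
    Int.modEq_iff_dvd.2 ⟨1, by ring⟩
  exact (by simpa [neg_mul, mul_neg] using h5 : lam * -x * (q : ℤ) ^ j ≡ -ρ [ZMOD _]).trans h6

/-- The conjugates of `{1, …, r}` and those of `{-1, …, -s}` partition the nonzero residues. -/
def CosetPartition (q n : ℕ) (r s : ℤ) : Prop :=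
  ∀ l : ℤ, ¬ l ≡ 0 [ZMOD n] →
    ((∃ i ∈ Set.Icc 1 r, CosetConj q n l i) ↔ ¬ ∃ i ∈ Set.Icc 1 s, CosetConj q n (-l) i)

theorem CosetPartition.symm {r s : ℤ} (h : CosetPartition q n r s) : CosetPartition q n s r := by
  intro l hl
  have h1 := h (-l) fun h2 => hl (by simpa using h2.neg)
  rw [neg_neg] at h1
  rw [h1, not_not]

variable {r s : ℤ}

/-- The residue `-k` belongs to the side of `s`, and its conjugate `n - k * q ^ (m - 1)` is
positive, so it must exceed `r`. -/
theorem CosetPartition.mul_lt (h : CosetPartition q n r s) (hm : 2 ≤ m) (hq : 3 ≤ q)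
    (hlam : 0 < lam) (hN : (lam : ℤ) * n = (q : ℤ) ^ m - 1) (hs : s < n) {k : ℤ} (hk : 1 ≤ k)
    (hks : k ≤ s) (hkq : lam * k ≤ q - 1) :
    lam * r < (q : ℤ) ^ m - 1 - lam * k * (q : ℤ) ^ (m - 1) := by
  have hlam' : (0 : ℤ) < lam := by exact_mod_cast hlam
  have hqZ : (3 : ℤ) ≤ q := by exact_mod_cast hq
  have hQ : (1 : ℤ) < (q : ℤ) ^ (m - 1) := one_lt_pow₀ (by linarith) (by lia)
  have hqm : (q : ℤ) ^ m = q * (q : ℤ) ^ (m - 1) := by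
    rw [← pow_succ', Nat.sub_add_cancel (by lia)]
  set Q := (q : ℤ) ^ (m - 1)
  have hpos : 0 < n - k * Q := by
    refine pos_of_mul_pos_right (a := (lam : ℤ)) ?_ hlam'.le
    rw [mul_sub, hN, hqm, ← mul_assoc]
    nlinarith
  suffices hr : r < n - k * Q by
    have := mul_lt_mul_of_pos_left hr hlam'
    rw [mul_sub, hN, ← mul_assoc] at this
    exact this
  by_contra! hr
  have h0 : ¬ -k ≡ 0 [ZMOD n] := by
    intro h0
    have h1 : k ≡ 0 [ZMOD n] := by simpa using h0.neg
    have := h1.eq_of_nonneg_of_lt (by linarith) (by linarith) le_rfl (by linarith)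
    linarith
  refine (h (-k) h0).1 ⟨n - k * Q, ⟨by linarith, hr⟩, m - 1, ?_⟩ ⟨k, ⟨hk, hks⟩, ?_⟩
  · exact Int.modEq_iff_dvd.2 ⟨1, by ring⟩
  · rw [neg_neg]
    exact CosetConj.refl k

theorem shiftsIn_add_sub_one (hm : 2 ≤ m) (hq : 3 ≤ q) {μ x : ℤ} (hμ : 2 ≤ μ)
    (hx : lam * x = q + μ - 1) :
    ShiftsIn q m lam x (q + μ - 1) (μ * (q : ℤ) ^ (m - 1)) := by
  have hqZ : (3 : ℤ) ≤ q := by exact_mod_cast hq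
  intro j hj
  rw [hx]
  rcases Nat.lt_or_ge (j + 1) m with hj' | hj'
  · refine ⟨_, ?_, ?_, rfl⟩
    · exact le_mul_of_one_le_right (by linarith) (one_le_pow₀ (by linarith))
    · have h1 : (q : ℤ) ^ (j + 1) ≤ (q : ℤ) ^ (m - 1) :=
        pow_le_pow_right₀ (by linarith) (by lia)
      have h2 : (q : ℤ) ^ j ≤ (q : ℤ) ^ (m - 1) := pow_le_pow_right₀ (by linarith) (by lia)
      rw [pow_succ] at h1
      nlinarith
  · obtain rfl : j = m - 1 := by lia
    have hqm : (q : ℤ) ^ m = q * (q : ℤ) ^ (m - 1) := by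
      rw [← pow_succ', Nat.sub_add_cancel (by lia)]
    have h1 : (q : ℤ) ≤ (q : ℤ) ^ (m - 1) := le_self_pow₀ (by linarith) (by lia)
    -- The last rotation wraps around: the term `q * q ^ (m - 1) = q ^ m` becomes 1.
    refine ⟨1 + (μ - 1) * (q : ℤ) ^ (m - 1), by nlinarith, by nlinarith, ?_⟩
    refine (Int.modEq_iff_dvd.2 ⟨1, ?_⟩).symm
    rw [hqm]
    ring

/-- For `lam * x = q + μ - 1`, if `x` is covered by `s`, its smallest rotation gives the bound.
Otherwise `-x` is covered by `r`, so `lam * r ≥ q ^ m - 1 - μ * q ^ (m - 1)`, against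
`CosetPartition.mul_lt`. -/
theorem CosetPartition.le_mul (h : CosetPartition q n r s) (hm : 2 ≤ m) (hq : 3 ≤ q)
    (hlam : 0 < lam) (hN : (lam : ℤ) * n = (q : ℤ) ^ m - 1) (hlamq : (lam : ℤ) ∣ q - 1)
    (hr : r < n) (hs : s < n) {μ : ℤ} (hlamμ : (lam : ℤ) ∣ μ) (hμ : 2 ≤ μ) (hμq : μ ≤ q - 1)
    (hμs : μ ≤ lam * s) : q + μ - 1 ≤ lam * s := by
  have hlam' : (0 : ℤ) < lam := by exact_mod_cast hlam
  have hqZ : (3 : ℤ) ≤ q := by exact_mod_cast hq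
  have hqm : (q : ℤ) ^ m = q * (q : ℤ) ^ (m - 1) := by
    rw [← pow_succ', Nat.sub_add_cancel (by lia)]
  have hQ : (1 : ℤ) < (q : ℤ) ^ (m - 1) := one_lt_pow₀ (by linarith) (by lia)
  obtain ⟨x, hx⟩ : (lam : ℤ) ∣ q + μ - 1 := by
    rw [show (q : ℤ) + μ - 1 = (q - 1) + μ by ring]
    exact dvd_add hlamq hlamμ
  obtain ⟨k, rfl⟩ := hlamμ
  have hk : 1 ≤ k := pos_of_mul_pos_right (by linarith) hlam'.le
  have hks : k ≤ s := le_of_mul_le_mul_left hμs hlam'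
  have h1 := h.mul_lt hm hq hlam hN hs hk hks hμq
  have hx' := shiftsIn_add_sub_one hm hq hμ hx.symm
  have hhi : lam * k * (q : ℤ) ^ (m - 1) < (q : ℤ) ^ m - 1 := by
    rw [hqm]
    nlinarith
  have h0 := hx'.not_modEq_zero (by lia) hN (by linarith) hhi
  by_cases hc : ∃ i ∈ Set.Icc 1 s, CosetConj q n x i
  · obtain ⟨i, hi, hc⟩ := hc
    exact hx'.le_of_conj (by lia) hN hlam (by linarith) hhi hi.1 hi.2 hs hc
  · obtain ⟨i, hi, hc⟩ := (h (-x) fun h2 => h0 (by simpa using h2.neg)).2 (by rwa [neg_neg])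
    have := hx'.neg.le_of_conj (by lia) hN hlam (by linarith) (by linarith) hi.1 hi.2 hr hc
    linarith

/-- The repunit `R = 1 + q + ⋯ + q ^ (m - 1)` is fixed by rotation. Rounding it up to a multiple of
`lam` adds at most `lam - 1 ≤ q - 3`, so a rotation only adds `(lam * x - R) * q ^ j` to `R`, too
little to leave the middle range. -/
theorem exists_shiftsIn_middle (hm : 2 ≤ m) (hq : 3 ≤ q) (hlam : 0 < lam) (hlamq : lam + 2 ≤ q) :
    ∃ x, ShiftsIn q m lam x ((q : ℤ) ^ (m - 1)) ((q : ℤ) ^ m - 1 - (q : ℤ) ^ (m - 1)) := by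
  have hlam' : (0 : ℤ) < lam := by exact_mod_cast hlam
  have hlamq' : (lam : ℤ) + 2 ≤ q := by exact_mod_cast hlamq
  have hqZ : (3 : ℤ) ≤ q := by exact_mod_cast hq
  have hqm : (q : ℤ) ^ m = q * (q : ℤ) ^ (m - 1) := by
    rw [← pow_succ', Nat.sub_add_cancel (by lia)]
  have hQ : (1 : ℤ) < (q : ℤ) ^ (m - 1) := one_lt_pow₀ (by linarith) (by lia)
  obtain ⟨R, hR⟩ : (q : ℤ) - 1 ∣ (q : ℤ) ^ m - 1 := by simpa using sub_dvd_pow_sub_pow (q : ℤ) 1 m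
  have hR1 : (q : ℤ) ^ (m - 1) ≤ R := by
    by_contra! hlt
    nlinarith
  have hR2 : R ≤ 2 * (q : ℤ) ^ (m - 1) - 1 := by
    by_contra! hlt
    nlinarith
  refine ⟨(R + lam - 1) / lam, fun j hj => ?_⟩
  have hd1 := Int.mul_ediv_add_emod (R + lam - 1) lam
  have hd2 := Int.emod_nonneg (R + lam - 1) hlam'.ne'
  have hd3 := Int.emod_lt_of_pos (R + lam - 1) hlam'
  set x := (R + lam - 1) / (lam : ℤ)
  have hj1 : (1 : ℤ) ≤ (q : ℤ) ^ j := one_le_pow₀ (by linarith)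
  have hj2 : (q : ℤ) ^ j ≤ (q : ℤ) ^ (m - 1) := pow_le_pow_right₀ (by linarith) (by lia)
  have ha0 : 0 ≤ lam * x - R := by linarith
  have ha1 : lam * x - R ≤ q - 3 := by linarith
  refine ⟨R + (lam * x - R) * (q : ℤ) ^ j, ?_, ?_, ?_⟩
  · nlinarith
  · have := mul_le_mul ha1 hj2 (by linarith) (by linarith)
    rw [hqm]
    linarith
  · obtain ⟨t, ht⟩ : (q : ℤ) - 1 ∣ (q : ℤ) ^ j - 1 := by
      simpa using sub_dvd_pow_sub_pow (q : ℤ) 1 j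
    refine (Int.modEq_iff_dvd.2 ⟨t, ?_⟩).symm
    rw [hR]
    linear_combination R * ht

/-- `CosetPartition.le_mul`, applied on both sides, makes `k = (q - 1) / lam` admissible in
`CosetPartition.mul_lt`. This pushes `lam * r` and `lam * s` below `q ^ (m - 1)`, leaving the middle
element uncovered. -/
theorem not_cosetPartition (hm : 2 ≤ m) (hq : 3 ≤ q) (hlam : 0 < lam) (hlamq : lam + 2 ≤ q)
    (hN : (lam : ℤ) * n = (q : ℤ) ^ m - 1) (hdvd : (lam : ℤ) ∣ q - 1)
    (hr : r < n) (hs : s < n) {μ : ℤ} (hlamμ : (lam : ℤ) ∣ μ) (hμ : 2 ≤ μ) (hμq : μ ≤ q - 1)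
    (hμr : μ ≤ lam * r) (hμs : μ ≤ lam * s) : ¬ CosetPartition q n r s := by
  intro h
  have hlam' : (0 : ℤ) < lam := by exact_mod_cast hlam
  have hqZ : (3 : ℤ) ≤ q := by exact_mod_cast hq
  have hqm : (q : ℤ) ^ m = q * (q : ℤ) ^ (m - 1) := by
    rw [← pow_succ', Nat.sub_add_cancel (by lia)]
  have hQ : (1 : ℤ) < (q : ℤ) ^ (m - 1) := one_lt_pow₀ (by linarith) (by lia)
  have h1 := h.le_mul hm hq hlam hN hdvd hr hs hlamμ hμ hμq hμs
  have h2 := h.symm.le_mul hm hq hlam hN hdvd hs hr hlamμ hμ hμq hμr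
  obtain ⟨k, hk⟩ := id hdvd
  have hk1 : 1 ≤ k := pos_of_mul_pos_right (a := (lam : ℤ)) (by linarith) hlam'.le
  have hks : k ≤ s := le_of_mul_le_mul_left (by linarith) hlam'
  have hkr : k ≤ r := le_of_mul_le_mul_left (by linarith) hlam'
  have h3 := h.mul_lt hm hq hlam hN hs hk1 hks hk.ge
  have h4 := h.symm.mul_lt hm hq hlam hN hr hk1 hkr hk.ge
  rw [← hk, hqm] at h3 h4
  obtain ⟨x, hx⟩ := exists_shiftsIn_middle hm hq hlam hlamq
  have h0 := hx.not_modEq_zero (by lia) hN (by linarith) (by linarith)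
  by_cases hc : ∃ i ∈ Set.Icc 1 r, CosetConj q n x i
  · obtain ⟨i, hi, hc⟩ := hc
    have := hx.le_of_conj (by lia) hN hlam (by linarith) (by linarith) hi.1 hi.2 hr hc
    linarith
  · obtain ⟨i, hi, hc⟩ := not_not.1 (mt (h x h0).2 hc)
    have := hx.neg.le_of_conj (by lia) hN hlam (by linarith) (by linarith) hi.1 hi.2 hs hc
    linarith

/-- For `n = q ^ m - 1`, every nonzero coset other than that of `-1` has an element
below `n - q ^ (m - 1)`. -/
theorem exists_lt_of_not_conj_neg_one (hm : 2 ≤ m) (hq : 3 ≤ q) (hN : (n : ℤ) = (q : ℤ) ^ m - 1)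
    {l : ℤ} (hl : ¬ CosetConj q n l (-1)) :
    ∃ i, 0 ≤ i ∧ i < n - (q : ℤ) ^ (m - 1) ∧ CosetConj q n l i := by
  have hqZ : (3 : ℤ) ≤ q := by exact_mod_cast hq
  have hqm : (q : ℤ) ^ m = q * (q : ℤ) ^ (m - 1) := by
    rw [← pow_succ', Nat.sub_add_cancel (by lia)]
  have hQ : (1 : ℤ) < (q : ℤ) ^ (m - 1) := one_lt_pow₀ (by linarith) (by lia)
  by_contra! h
  have hn0 : (0 : ℤ) < n := by nlinarith
  -- If the whole coset lies in the top `q ^ (m - 1)` residues, the distances `d j` to `n` never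
  -- wrap around: `d j = q ^ (m - 1)` would make `l` conjugate to `-1`. So they grow by the factor
  -- `q` forever, contradicting the bound.
  have hd : ∀ j : ℕ, ∃ d : ℤ, 0 < d ∧ d ≤ (q : ℤ) ^ (m - 1) ∧ -l * (q : ℤ) ^ j ≡ d [ZMOD n] := by
    intro j
    have h1 := Int.emod_nonneg (l * (q : ℤ) ^ j) hn0.ne'
    have h2 := Int.emod_lt_of_pos (l * (q : ℤ) ^ j) hn0
    have h3 : l * (q : ℤ) ^ j ≡ l * (q : ℤ) ^ j % n [ZMOD n] := (Int.mod_modEq _ _).symm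
    have h4 := mt (h _ h1) (not_not.2 ⟨j, h3⟩)
    refine ⟨n - l * (q : ℤ) ^ j % n, by linarith, by linarith, ?_⟩
    have h5 := h3.neg
    rw [← neg_mul] at h5
    exact h5.trans (Int.modEq_iff_dvd.2 ⟨1, by ring⟩)
  choose d hd0 hdQ hd using hd
  have hstep : ∀ j, d (j + 1) = d j * q := by
    intro j
    have h1 : d (j + 1) ≡ d j * q [ZMOD n] := by
      refine (hd (j + 1)).symm.trans ?_
      rw [pow_succ, ← mul_assoc]
      exact (hd j).mul_right _
    have h2 : d j ≠ (q : ℤ) ^ (m - 1) := by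
      intro h2
      refine hl ⟨j + 1, ?_⟩
      have h3 : -l * (q : ℤ) ^ (j + 1) ≡ 1 [ZMOD n] := by
        refine (hd (j + 1)).trans (h1.trans (Int.modEq_iff_dvd.2 ⟨-1, ?_⟩))
        rw [h2, hN, hqm]
        ring
      simpa [neg_mul] using h3.neg
    have h3 : d j ≤ (q : ℤ) ^ (m - 1) - 1 := by
      have := lt_of_le_of_ne (hdQ j) h2
      linarith
    have := hd0 j
    refine h1.eq_of_nonneg_of_lt (hd0 _).le ?_ (by nlinarith) ?_
    · have := hdQ (j + 1)
      nlinarith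
    · nlinarith
  have hpow : ∀ j, (q : ℤ) ^ j ≤ d j := by
    intro j
    induction j with
    | zero =>
      rw [pow_zero]
      exact hd0 0
    | succ j ih =>
      rw [hstep, pow_succ]
      exact mul_le_mul_of_nonneg_right ih (by linarith)
  have h1 := hpow m
  have h2 := hdQ m
  nlinarith

/-- The coset of `-1` consists of the `n - q ^ j` with `j < m`. -/
theorem le_of_conj_neg_one (hm : 2 ≤ m) (hq : 3 ≤ q) (hN : (n : ℤ) = (q : ℤ) ^ m - 1)
    {i : ℤ} (hi0 : 0 ≤ i) (hin : i < n) (h : CosetConj q n (-1) i) :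
    n - (q : ℤ) ^ (m - 1) ≤ i := by
  have hqZ : (3 : ℤ) ≤ q := by exact_mod_cast hq
  have hqm : (q : ℤ) ^ m = q * (q : ℤ) ^ (m - 1) := by
    rw [← pow_succ', Nat.sub_add_cancel (by lia)]
  have hQ : (1 : ℤ) < (q : ℤ) ^ (m - 1) := one_lt_pow₀ (by linarith) (by lia)
  obtain ⟨j, hj, h⟩ := h.exists_lt (by lia : 0 < m)
    (pow_modEq_one_of_mul_eq (lam := 1) (by simpa using hN))
  have hj1 : (1 : ℤ) ≤ (q : ℤ) ^ j := one_le_pow₀ (by linarith)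
  have hj2 : (q : ℤ) ^ j ≤ (q : ℤ) ^ (m - 1) := pow_le_pow_right₀ (by linarith) (by lia)
  have h1 : n - (q : ℤ) ^ j ≡ i [ZMOD n] :=
    Int.ModEq.trans (Int.modEq_iff_dvd.2 ⟨-1, by ring⟩) h
  have := h1.eq_of_nonneg_of_lt (by nlinarith) (by linarith) hi0 hin
  linarith

end Combinatorics

/-! ### Coset leaders -/

section CosetLeaders

variable {q n a : ℕ}

theorem IsCosetLeader.lt (h : IsCosetLeader q n a) : a < n := by
  obtain ⟨s, hs, ⟨j, rfl⟩, -⟩ := h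
  exact Nat.mod_lt _ (by lia)

theorem IsCosetLeader.le_of_conj (h : IsCosetLeader q n a) {i : ℤ} (hi0 : 0 ≤ i) (hin : i < n)
    (hc : CosetConj q n a i) : (a : ℤ) ≤ i := by
  obtain ⟨s, hs, ⟨j, hj⟩, hle⟩ := h
  obtain ⟨k, hk⟩ := hc
  lift i to ℕ using hi0
  have h1 : a ≡ s * q ^ j [MOD n] := hj ▸ Nat.mod_modEq _ _
  have h2 : a * q ^ k ≡ i [MOD n] := (Int.natCast_modEq_iff).1 (by exact_mod_cast hk)
  have h3 : s * q ^ (j + k) ≡ i [MOD n] := by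
    rw [pow_add, ← mul_assoc]
    exact (h1.symm.mul_right _).trans h2
  have h4 : i = s * q ^ (j + k) % n := by
    rw [h3, Nat.mod_eq_of_lt (by exact_mod_cast hin)]
  exact_mod_cast hle ⟨_, h4⟩

theorem IsCosetLeader.eq_of_conj {b : ℕ} (ha : IsCosetLeader q n a) (hb : IsCosetLeader q n b)
    (hab : CosetConj q n a b) (hba : CosetConj q n b a) : a = b := by
  have h1 := ha.le_of_conj (by lia) (by exact_mod_cast hb.lt) hab
  have h2 := hb.le_of_conj (by lia) (by exact_mod_cast ha.lt) hba
  lia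

theorem exists_isCosetLeader_conj (hn : n ≠ 0) (l : ℤ) :
    ∃ a, IsCosetLeader q n a ∧ CosetConj q n l a := by
  obtain ⟨s, hs⟩ := Int.eq_ofNat_of_zero_le (Int.emod_nonneg l (Int.natCast_ne_zero.2 hn))
  have hsn : s < n := by
    have := Int.emod_lt_of_pos l (by lia : (0 : ℤ) < n)
    lia
  have hne : (cyclotomicCoset q n s).Nonempty := ⟨_, 0, rfl⟩
  have hmem := Nat.sInf_mem hne
  refine ⟨_, ⟨s, hsn, hmem, fun _ ht => Nat.sInf_le ht⟩, ?_⟩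
  obtain ⟨j, hj⟩ := hmem
  refine ⟨j, ?_⟩
  have h1 : l ≡ s [ZMOD n] := by
    rw [← hs]
    exact (Int.mod_modEq _ _).symm
  rw [hj]
  refine (h1.mul_right _).trans ?_
  push_cast
  exact (Int.mod_modEq _ _).symm

end CosetLeaders

/-! ### Intervals describing the zeros of the dual -/

section Duals

variable {q n : ℕ}

theorem cosetPartition_of_forall_iff {m : ℕ} (hm : 0 < m) (hqm : (q : ℤ) ^ m ≡ 1 [ZMOD n])
    {b r s : ℤ} (hs1 : 1 ≤ s) (hs : s < n)
    (h : ∀ l : ℤ, (∃ i ∈ Set.Icc b (b + r), CosetConj q n l i) ↔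
      ∀ i ∈ Set.Icc 1 s, ¬ CosetConj q n (-l) i) :
    CosetPartition q n r s := by
  obtain ⟨i, hi, h0⟩ := (h 0).2 (by
    rintro i ⟨hi1, hi2⟩ hc
    have := (hc.eq_zero (by simp)).eq_of_nonneg_of_lt (by linarith) (by linarith) le_rfl
      (by linarith)
    linarith)
  have hi0 := h0.eq_zero rfl
  have hib : i = b := by
    by_contra hne
    have hlt := lt_of_le_of_ne hi.1 (Ne.symm hne)
    -- If `b < i`, the interval also contains `i - 1 ≡ -1`, which is not a zero exponent of the dual
    -- because `1 ≤ s`.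
    refine (h (i - 1)).1 ⟨i - 1, ⟨by lia, by linarith [hi.2]⟩, CosetConj.refl _⟩ 1 ⟨le_rfl, hs1⟩
      (CosetConj.of_modEq ?_)
    have h1 := hi0.neg.add_left 1
    rwa [neg_zero, add_zero, ← sub_eq_add_neg, ← neg_sub] at h1
  subst hib
  intro l hl
  have h1 : (∃ j ∈ Set.Icc 1 r, CosetConj q n l j) ↔
      ∃ j ∈ Set.Icc i (i + r), CosetConj q n l j := by
    constructor
    · rintro ⟨j, ⟨hj1, hj2⟩, hc⟩
      refine ⟨i + j, ⟨by linarith, by linarith⟩, hc.trans (CosetConj.of_modEq ?_)⟩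
      simpa using (hi0.symm.add_right j)
    · rintro ⟨j, ⟨hj1, hj2⟩, hc⟩
      have hne : j ≠ i := by
        rintro rfl
        exact hc.not_zero hm hqm hl hi0
      refine ⟨j - i, ⟨by lia, by linarith⟩, hc.trans (CosetConj.of_modEq ?_)⟩
      simpa using (hi0.symm.sub_left j)
  rw [h1, h l]
  push Not
  rfl

theorem IsCosetLeader.not_conj {a : ℕ} (ha : IsCosetLeader q n a) {s : ℤ} (hs : s < n)
    (has : s < a) : ∀ i ∈ Set.Icc 1 s, ¬ CosetConj q n a i := by
  rintro i ⟨hi1, hi2⟩ hc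
  have := ha.le_of_conj (by linarith) (by linarith) hc
  linarith

theorem CosetPartition.exists_conj_neg {r s : ℤ} (h : CosetPartition q n r s) {a : ℕ}
    (ha : IsCosetLeader q n a) (ha0 : 0 < a) (hs : s < n) (has : s < a) :
    ∃ i ∈ Set.Icc 1 r, CosetConj q n (-a) i := by
  refine (h (-a) ?_).2 ?_
  · intro h0
    have h1 : (a : ℤ) ≡ 0 [ZMOD n] := by simpa using h0.neg
    have := h1.eq_of_nonneg_of_lt (by lia) (by exact_mod_cast ha.lt) le_rfl
      (by exact_mod_cast ha0.trans ha.lt)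
    lia
  · rw [neg_neg]
    rintro ⟨i, hi, hc⟩
    exact ha.not_conj hs has i hi hc

theorem not_conj_of_modEq_zero {l s : ℤ} (hl : l ≡ 0 [ZMOD n]) (hs : s < n) :
    ∀ i ∈ Set.Icc 1 s, ¬ CosetConj q n l i := by
  rintro i ⟨hi1, hi2⟩ hc
  have := (hc.eq_zero hl).eq_of_nonneg_of_lt (by linarith) (by linarith) le_rfl (by linarith)
  linarith

/-- If all nonzero coset leaders are at most `s`, only the zero coset is missed by `{1, …, s}`. -/
theorem conj_zero_iff_of_leader_le {m : ℕ} (hm : 0 < m) (hqm : (q : ℤ) ^ m ≡ 1 [ZMOD n])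
    (hn : n ≠ 0) {s : ℤ} (hs : s < n) (h : ∀ a, IsCosetLeader q n a → (a : ℤ) ≤ s) (l : ℤ) :
    (∃ i ∈ Set.Icc (0 : ℤ) 0, CosetConj q n l i) ↔
      ∀ i ∈ Set.Icc 1 s, ¬ CosetConj q n (-l) i := by
  constructor
  · rintro ⟨i, hi, hc⟩
    obtain rfl : i = 0 := by simpa using hi
    exact not_conj_of_modEq_zero (by simpa using ((hc.symm hm hqm).eq_zero rfl).neg) hs
  · intro hl
    obtain ⟨a, ha, hla⟩ := exists_isCosetLeader_conj (q := q) hn (-l)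
    have h0 : ¬ 1 ≤ (a : ℤ) := fun h1 => hl a ⟨h1, h a ha⟩ hla
    obtain rfl : a = 0 := by lia
    exact ⟨0, by simp, by simpa using hla.neg⟩

theorem conj_Icc_zero_iff_not_conj_one {m : ℕ} (hm : 2 ≤ m) (hq : 3 ≤ q)
    (hN : (n : ℤ) = (q : ℤ) ^ m - 1) (l : ℤ) :
    (∃ i ∈ Set.Icc 0 (n - (q : ℤ) ^ (m - 1) - 1), CosetConj q n l i) ↔
      ∀ i ∈ Set.Icc (1 : ℤ) 1, ¬ CosetConj q n (-l) i := by
  have hqm := pow_modEq_one_of_mul_eq (lam := 1) (by simpa using hN)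
  have hm0 : 0 < m := by lia
  have hQ : (0 : ℤ) < (q : ℤ) ^ (m - 1) := pow_pos (by lia) _
  constructor
  · rintro ⟨i, ⟨hi0, hi1⟩, hc⟩ j hj hcj
    obtain rfl : j = 1 := le_antisymm hj.2 hj.1
    have h1 := (by simpa using hcj.neg : CosetConj q n l (-1))
    have := le_of_conj_neg_one hm hq hN hi0 (by linarith) ((h1.symm hm0 hqm).trans hc)
    linarith
  · intro h
    obtain ⟨i, hi0, hi, hc⟩ := exists_lt_of_not_conj_neg_one hm hq hN (l := l)
      fun hc => h 1 (by simp) (by simpa using hc.neg)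
    exact ⟨i, ⟨hi0, by linarith⟩, hc⟩

/-- For `n = q ^ m - 1` the largest coset leader is conjugate to `-1`. -/
theorem conj_neg_one_of_isGreatest {m : ℕ} (hm : 2 ≤ m) (hq : 3 ≤ q)
    (hN : (n : ℤ) = (q : ℤ) ^ m - 1) {a : ℕ} (ha : IsGreatest {a | IsCosetLeader q n a} a) :
    CosetConj q n a (-1) := by
  have hQ : (0 : ℤ) < (q : ℤ) ^ (m - 1) := pow_pos (by lia) _
  have hlt : a < n := IsCosetLeader.lt ha.1
  by_contra hc
  obtain ⟨i, hi0, hi, hc⟩ := exists_lt_of_not_conj_neg_one hm hq hN hc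
  have h1 := IsCosetLeader.le_of_conj ha.1 hi0 (by linarith) hc
  obtain ⟨c, hcl, hcc⟩ := exists_isCosetLeader_conj (q := q) (n := n) (by lia) (-1)
  have h2 := le_of_conj_neg_one hm hq hN (by lia) (by exact_mod_cast hcl.lt) hcc
  have h3 : (c : ℤ) ≤ a := by exact_mod_cast ha.2 hcl
  linarith

/-- Only the cosets of 0 and `δ₁` avoid `{1, …, s}`, and `δ₁` is conjugate to `-1`; negation turns
them into the cosets of 0 and 1. -/
theorem conj_Icc_zero_one_iff {m : ℕ} (hm : 2 ≤ m) (hq : 3 ≤ q)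
    (hN : (n : ℤ) = (q : ℤ) ^ m - 1) {δ₁ δ₂ : ℕ} (hδ₁ : IsGreatest {a | IsCosetLeader q n a} δ₁)
    (hδ₂ : IsGreatest {a | IsCosetLeader q n a ∧ a < δ₁} δ₂) {s : ℤ} (h₁ : s < δ₁) (h₂ : δ₂ ≤ s)
    (l : ℤ) :
    (∃ i ∈ Set.Icc (0 : ℤ) 1, CosetConj q n l i) ↔
      ∀ i ∈ Set.Icc 1 s, ¬ CosetConj q n (-l) i := by
  have hqm := pow_modEq_one_of_mul_eq (lam := 1) (by simpa using hN)
  have hm0 : 0 < m := by lia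
  have hδ₁l : IsCosetLeader q n δ₁ := hδ₁.1
  have hδ₁n := hδ₁l.lt
  have hconj := conj_neg_one_of_isGreatest hm hq hN hδ₁
  constructor
  · rintro ⟨i, ⟨hi0, hi1⟩, hc⟩
    obtain rfl | rfl : i = 0 ∨ i = 1 := by lia
    · exact not_conj_of_modEq_zero (by simpa using ((hc.symm hm0 hqm).eq_zero rfl).neg) (by lia)
    · intro j hj hcj
      exact hδ₁l.not_conj (by lia) h₁ j hj
        (hconj.trans ((hc.neg.symm hm0 hqm).trans hcj))
  · intro hl
    obtain ⟨a, ha, hla⟩ := exists_isCosetLeader_conj (q := q) (n := n) (by lia) (-l)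
    have ha1 : a ≤ δ₁ := hδ₁.2 ha
    rcases ha1.lt_or_eq with hlt | rfl
    · have ha2 : a ≤ δ₂ := hδ₂.2 ⟨ha, hlt⟩
      have h0 : ¬ 1 ≤ (a : ℤ) := fun h1 => hl a ⟨h1, by lia⟩ hla
      obtain rfl : a = 0 := by lia
      exact ⟨0, by simp, by simpa using hla.neg⟩
    · exact ⟨1, by simp, by simpa using (hla.trans hconj).neg⟩

end Duals

/-! ### The classification -/

theorem theorem7 {F : Type*} [Field F] [Fintype F] {K : Type*} [Field K] [Algebra F K]
    (q m lam n : ℕ) (hqF : Fintype.card F = q) (hmK : Module.finrank F K = m)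
    (hm : 2 ≤ m) (hq : 3 ≤ q) (hlam : lam ∣ q - 1) (hlam' : lam ≠ q - 1)
    (hn : n = (q ^ m - 1) / lam)
    (β : K) (hβ : IsPrimitiveRoot β n)
    (δ₁ δ₂ : ℕ) (hδ₁ : IsGreatest {a | IsCosetLeader q n a} δ₁)
    (hδ₂ : IsGreatest {a | IsCosetLeader q n a ∧ a < δ₁} δ₂)
    (δ : ℕ) (hδ : 2 ≤ δ) (hδn : δ ≤ n) :
    (lam ≠ 1 → (IsDuallyBCH β (bchCode F n β δ 1) ↔ δ₁ < δ ∧ δ ≤ n)) ∧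
    (lam = 1 → (IsDuallyBCH β (bchCode F n β δ 1) ↔ δ = 2 ∨ (δ₂ < δ ∧ δ ≤ n))) := by
  have : FiniteDimensional F K := Module.finite_of_finrank_pos (by lia)
  have : Finite K := Module.finite_of_finite F
  have hn0 : n ≠ 0 := by lia
  have hm0 : 0 < m := by lia
  have hlam0 : 0 < lam := Nat.pos_of_dvd_of_pos hlam (by lia)
  have hlamle : lam ≤ q - 1 := Nat.le_of_dvd (by lia) hlam
  have hlamq : lam + 2 ≤ q := by lia
  have hN : (lam : ℤ) * n = (q : ℤ) ^ m - 1 := by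
    have h1 : lam ∣ q ^ m - 1 := hlam.trans (by simpa using Nat.sub_dvd_pow_sub_pow q 1 m)
    have h2 : lam * n = q ^ m - 1 := by rw [hn, Nat.mul_div_cancel' h1]
    have h3 : 1 ≤ q ^ m := Nat.one_le_pow _ _ (by lia)
    have h4 : lam * n + 1 = q ^ m := by lia
    have h5 : (lam : ℤ) * n + 1 = (q : ℤ) ^ m := by exact_mod_cast h4
    linarith
  have hqm := pow_modEq_one_of_mul_eq hN
  have hlamdvd : (lam : ℤ) ∣ q - 1 := by
    have := Int.natCast_dvd_natCast.2 hlam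
    rwa [Nat.cast_sub (by lia), Nat.cast_one] at this
  have hδ₁l : IsCosetLeader q n δ₁ := hδ₁.1
  have hδ₂l : IsCosetLeader q n δ₂ := hδ₂.1.1
  have hlt : δ₂ < δ₁ := hδ₂.1.2
  have hdual : IsDuallyBCH β (bchCode F n β δ 1) ↔ ∃ (δ' : ℕ) (b : ℤ), 2 ≤ δ' ∧ δ' ≤ n ∧
      ∀ l : ℤ, (∃ i ∈ Set.Icc b (b + ((δ' : ℤ) - 2)), CosetConj q n l i) ↔
        ∀ i ∈ Set.Icc (1 : ℤ) (δ - 1), ¬ CosetConj q n (-l) i := by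
    rw [IsDuallyBCH, and_iff_right ⟨δ, 1, hδ, hδn, rfl⟩, IsBCHCode]
    simp only [codeDual_bchCode_eq_iff hβ hn0, hqF, add_sub_assoc]
    rw [show (1 : ℤ) + ((δ : ℤ) - 2) = δ - 1 by ring]
  have hpart : IsDuallyBCH β (bchCode F n β δ 1) →
      ∃ r : ℤ, r < n ∧ CosetPartition q n r ((δ : ℤ) - 1) := by
    rw [hdual]
    rintro ⟨δ', b, hδ'2, hδ'n, h⟩
    exact ⟨(δ' : ℤ) - 2, by lia, cosetPartition_of_forall_iff hm0 hqm (by lia) (by lia) h⟩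
  have hlarge : δ₁ < δ → IsDuallyBCH β (bchCode F n β δ 1) := by
    intro h
    refine hdual.2 ⟨2, 0, le_rfl, by lia, fun l => ?_⟩
    have hle : ∀ a, IsCosetLeader q n a → (a : ℤ) ≤ (δ : ℤ) - 1 := by
      intro a ha
      have : a ≤ δ₁ := hδ₁.2 ha
      lia
    simpa using conj_zero_iff_of_leader_le hm0 hqm hn0 (by lia : (δ : ℤ) - 1 < n) hle l
  constructor
  · intro hlam1
    refine ⟨fun h => ⟨?_, hδn⟩, fun h => hlarge h.1⟩
    obtain ⟨r, hr, hP⟩ := hpart h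
    by_contra! hle
    obtain ⟨i, hi, -⟩ := hP.exists_conj_neg hδ₁l (by lia) (by lia) (by lia)
    have hr1 : 1 ≤ r := hi.1.trans hi.2
    -- Here `μ = lam`, which is at least 2, so `r, s ≥ 1` suffices.
    exact not_cosetPartition hm hq hlam0 hlamq hN hlamdvd hr (by lia) dvd_rfl (by lia) (by lia)
      (le_mul_of_one_le_right (by lia) hr1) (le_mul_of_one_le_right (by lia) (by lia)) hP
  · rintro rfl
    have hN1 : (n : ℤ) = (q : ℤ) ^ m - 1 := by simpa using hN
    have hqZ : (3 : ℤ) ≤ q := by exact_mod_cast hq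
    have hQpow : (q : ℤ) ^ m = q * (q : ℤ) ^ (m - 1) := by
      rw [← pow_succ', Nat.sub_add_cancel (by lia)]
    have hQ : (1 : ℤ) < (q : ℤ) ^ (m - 1) := one_lt_pow₀ (by linarith) (by lia)
    constructor
    · intro h
      obtain ⟨r, hr, hP⟩ := hpart h
      by_contra! hne
      have hδ₂le : δ ≤ δ₂ := by
        by_contra! h2
        exact absurd (hne.2 h2) (by lia)
      obtain ⟨i, ⟨hi, hir⟩, hci⟩ := hP.exists_conj_neg hδ₁l (by lia) (by lia) (by lia)
      obtain ⟨k, ⟨hk, hkr⟩, hck⟩ := hP.exists_conj_neg hδ₂l (by lia) (by lia) (by lia)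
      -- Distinct leaders have distinct cosets, so `-δ₁` and `-δ₂` cannot both be conjugate to 1.
      have hr2 : 2 ≤ r := by
        by_contra! hr2
        obtain rfl : i = 1 := by lia
        obtain rfl : k = 1 := by lia
        have h1 := (hci.trans (hck.symm hm0 hqm)).neg
        have h2 := (hck.trans (hci.symm hm0 hqm)).neg
        rw [neg_neg, neg_neg] at h1 h2
        exact hlt.ne' (hδ₁l.eq_of_conj hδ₂l h1 h2)
      have := hne.1
      exact not_cosetPartition (μ := 2) hm hq hlam0 hlamq hN hlamdvd hr (by lia) (by simp) le_rfl
        (by lia) (by lia) (by lia) hP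
    · rintro (rfl | ⟨h, -⟩)
      · obtain ⟨L, hL⟩ : ∃ L : ℕ, (n : ℤ) - (q : ℤ) ^ (m - 1) = L :=
          Int.eq_ofNat_of_zero_le (by nlinarith)
        -- Designed distance `L + 1` with offset 0 gives the exponents `0, …, L - 1`.
        refine hdual.2 ⟨L + 1, 0, ?_, ?_, fun l => ?_⟩
        · have : (1 : ℤ) ≤ L := by nlinarith
          lia
        · have : (L : ℤ) + 1 ≤ n := by linarith
          lia
        · have := conj_Icc_zero_iff_not_conj_one hm hq hN1 l
          rw [hL] at this
          rw [show (0 : ℤ) + (((L + 1 : ℕ) : ℤ) - 2) = L - 1 by push_cast; ring,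
            show ((2 : ℕ) : ℤ) - 1 = 1 by norm_num]
          exact this
      · rcases Nat.lt_or_ge δ₁ δ with h1 | h1
        · exact hlarge h1
        · refine hdual.2 ⟨3, 0, by lia, ?_, fun l => ?_⟩
          · have : (3 : ℤ) ≤ n := by nlinarith
            lia
          · simpa using conj_Icc_zero_one_iff hm hq hN1 hδ₁ hδ₂
              (by lia : (δ : ℤ) - 1 < δ₁) (by lia) l
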